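/- Fix a path loss exponent $\alpha>2$, a link distance $R>0$, an SIR threshold $\theta>0$, a target outage probability $\epsilon\in(0,1)$ and $\nu>0$. For $\lambda>0$ and $p\in(0,1]$ consider the Poisson bipolar network with ALOHA and Rayleigh fading: the potential transmitters form a homogeneous Poisson point process $\Phi$ of density $\lambda$ on $\mathbb{R}^2$; each $x\in\Phi$ independently transmits (at unit power) with probability $p$, indicated by $B_x\in\{0,1\}$; the typical link has its transmitter at $(R,0)$ (not a point of $\Phi$, and active) and its receiver at the origin; the channel power gains $g$ (of the typical link) and $h_x$, $x\in\Phi$, are i.i.d. exponential with mean $1$; and $\Phi$, the $B_x$, the $h_x$ and $g$ are independent. Put $$\mathsf{SIR}=\frac{g\,R^{-\alpha}}{\sum_{x\in\Phi}B_x h_x\|x\|^{-\alpha}},\qquad P_{\rm s}(\theta)=\mathbb P(\mathsf{SIR}>\theta\mid\Phi),\qquad p_{\rm s}(\theta)=\mathbb P(\mathsf{SIR}>\theta),$$ $$\eta(\theta,\epsilon)=\mathbb P\big(P_{\rm s}(\theta)>1-\epsilon\big),\qquad \lambda_\epsilon=\lambda\,p\,\eta(\theta,\epsilon),$$ the last being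 the density of reliable links. Keep $\lambda p=\nu$ fixed, i.e. $\lambda=\nu/p$, and let the constrained spatial outage capacity be $\tilde S(\theta,\epsilon)=\lim_{p\to0,\ \lambda p=\nu}\lambda_\epsilon$. Then $p_{\rm s}(\theta)$ has the same value for all $p\in(0,1]$ with $\lambda p=\nu$, the limit exists whenever $1-\epsilon\neq p_{\rm s}(\theta)$, and $$\tilde S(\theta,\epsilon)=\begin{cases}\lambda p=\nu, & \text{if } 1-\epsilon<p_{\rm s}(\theta),\\ 0, & \text{if } 1-\epsilon>p_{\rm s}(\theta).\end{cases}$$ -/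

import Mathlib

open MeasureTheory ProbabilityTheory Filter Topology
open scoped ENNReal NNReal

/-- The Euclidean plane. -/
abbrev Plane : Type := EuclideanSpace ℝ (Fin 2)

/-- The random elements of a bipolar network with ALOHA and fading, seen from the receiver of the
typical link, which is located at the origin:
* `X i` is the location of the `i`-th potential interferer,
* `active i` tells whether it transmits in the time slot (random channel access),
* `h i` is the channel power gain (fading) from `X i` to the origin,
* `g` is the channel power gain of the desired (typical) link. -/
structure BipolarNetwork (Ω : Type*) [MeasurableSpace Ω] where
  X : ℕ → Ω → Plane
  active : ℕ → Ω → Bool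
  h : ℕ → Ω → ℝ
  g : Ω → ℝ
  measurable_X : ∀ i, Measurable (X i)
  measurable_active : ∀ i, Measurable (active i)
  measurable_h : ∀ i, Measurable (h i)
  measurable_g : Measurable g

/-- The (random) counting measure of a (random) sequence of points of the plane. -/
noncomputable def countingMeasure {Ω : Type*} (X : ℕ → Ω → Plane) (ω : Ω) : Measure Plane :=
  Measure.sum fun i => Measure.dirac (X i ω)

/-- The point process `∑ i, δ_{X i}` is a homogeneous Poisson point process of density `lam` on
the plane: the number of points in a Borel set `A` of finite area is Poisson distributed with mean
`lam * area A`, and the numbers of points in disjoint Borel sets are independent. -/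
structure IsHomogeneousPPP {Ω : Type*} [MeasurableSpace Ω] (μ : Measure Ω) (lam : ℝ)
    (X : ℕ → Ω → Plane) : Prop where
  hasLaw_count : ∀ A : Set Plane, MeasurableSet A → volume A ≠ ∞ →
    HasLaw (fun ω => countingMeasure X ω A)
      ((poissonMeasure (lam.toNNReal * (volume A).toNNReal)).map (Nat.cast : ℕ → ℝ≥0∞)) μ
  indep_count : ∀ (n : ℕ) (A : Fin n → Set Plane), (∀ k, MeasurableSet (A k)) →
    Pairwise (fun k l => Disjoint (A k) (A l)) →
    iIndepFun (fun k ω => countingMeasure X ω (A k)) μ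

namespace BipolarNetwork

variable {Ω : Type*} [MeasurableSpace Ω]

/-- The network is a Poisson bipolar network with ALOHA and Rayleigh fading: the potential
transmitters form a homogeneous PPP of density `lam`, every one of them is active with
probability `p`, all channel power gains are exponential with mean `1`, and the point process, the
gain of the desired link, all the access decisions and all the other gains are independent. -/
structure IsPoissonAlohaRayleigh (N : BipolarNetwork Ω) (μ : Measure Ω) (lam p : ℝ) : Prop where
  ppp : IsHomogeneousPPP μ lam N.X
  prob_active : ∀ i, μ {ω | N.active i ω = true} = ENNReal.ofReal p
  hasLaw_h : ∀ i, HasLaw (N.h i) (expMeasure 1) μ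
  hasLaw_g : HasLaw N.g (expMeasure 1) μ
  iIndep_active : iIndepFun N.active μ
  iIndep_h : iIndepFun N.h μ
  indep_active_h : IndepFun (fun ω i => N.active i ω) (fun ω i => N.h i ω) μ
  indep_g : IndepFun N.g (fun ω => ((fun i => N.active i ω), (fun i => N.h i ω))) μ
  indep_X : IndepFun (fun ω i => N.X i ω)
    (fun ω => (N.g ω, (fun i => N.active i ω), (fun i => N.h i ω))) μ

/-- Power path loss law `‖x‖ ^ (-α)` between `x` and the origin. -/
noncomputable def pathLoss (α : ℝ) (x : Plane) : ℝ≥0∞ := ‖x‖ₑ ^ (-α)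

/-- Interference power received at the origin from the active interferers (unit power). -/
noncomputable def interference (N : BipolarNetwork Ω) (α : ℝ) (ω : Ω) : ℝ≥0∞ :=
  ∑' i, if N.active i ω = true then ENNReal.ofReal (N.h i ω) * pathLoss α (N.X i ω) else 0

/-- Signal-to-interference ratio of the typical link, whose transmitter is located at `(R, 0)` and
whose receiver is located at the origin. -/
noncomputable def sir (N : BipolarNetwork Ω) (α R : ℝ) (ω : Ω) : ℝ≥0∞ :=
  ENNReal.ofReal (N.g ω) * pathLoss α !₂[R, 0] / N.interference α ω

/-- The event `SIR > θ`. -/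
def successEvent (N : BipolarNetwork Ω) (α R θ : ℝ) : Set Ω :=
  {ω | ENNReal.ofReal θ < N.sir α R ω}

/-- The σ-algebra generated by the point process `Φ = ∑ i, δ_{X i}`. -/
noncomputable abbrev sigmaPhi (N : BipolarNetwork Ω) : MeasurableSpace Ω :=
  MeasurableSpace.comap (countingMeasure N.X) inferInstance

/-- Conditional link success probability `P_s(θ) = P(SIR > θ ∣ Φ)`. -/
noncomputable def condSuccess (N : BipolarNetwork Ω) (μ : Measure Ω) (α R θ : ℝ) : Ω → ℝ :=
  μ⟦N.successEvent α R θ | N.sigmaPhi⟧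

/-- Mean success probability `p_s(θ) = P(SIR > θ)`. -/
noncomputable def meanSuccess (N : BipolarNetwork Ω) (μ : Measure Ω) (α R θ : ℝ) : ℝ :=
  μ.real (N.successEvent α R θ)

/-- Meta distribution of the SIR, `η(θ, ε) = P(P_s(θ) > 1 - ε)`. -/
noncomputable def metaDist (N : BipolarNetwork Ω) (μ : Measure Ω) (α R θ ε : ℝ) : ℝ :=
  μ.real {ω | 1 - ε < N.condSuccess μ α R θ ω}

/-- Density of reliable links `λ_ε = λ p η(θ, ε)`. -/
noncomputable def reliableDensity (N : BipolarNetwork Ω) (μ : Measure Ω)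
    (lam p α R θ ε : ℝ) : ℝ :=
  lam * p * N.metaDist μ α R θ ε

end BipolarNetwork

/-!
Given the point process `Φ` of potential transmitters, the gain `g` of the desired link exceeds a
level `t` with probability `e⁻ᵗ`, so the conditional success probability is the conditional mean of
`exp (-∑ B_x h_x w(x))`, where `w(x) = θ ‖x‖ ^ (-α) / R ^ (-α)`. Averaging over the independent
access decisions and gains turns it into the product `Y = ∏ (1 - p v(x))` over the points `x` of
`Φ`, with `v = w / (1 + w)` (`condSuccess_ae_eq`). This is the exponential of a linear functional
of `Φ`, so its moments come from the Laplace functional of the Poisson process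
(`IsHomogeneousPPP.lintegral_expNeg_lintegral`):

* `𝔼 Y = exp (-(ν / p) ∫ p v) = exp (-ν ∫ v)`, which does not depend on `p`;
* `𝔼 Y² = exp (-(ν / p) ∫ (1 - (1 - p v)²)) ≤ exp (-ν (2 - p) ∫ v) = (𝔼 Y) ^ (2 - p)`, as `v² ≤ v`.

Hence the variance of `Y` is at most `(𝔼 Y) ^ (2 - p) - (𝔼 Y) ^ 2`, which tends to `0` with `p`. By
Chebyshev's inequality the conditional success probability concentrates at the mean success
probability, so it exceeds `1 - ε` with probability tending to `1` or to `0` according to the side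
of `𝔼 Y` on which `1 - ε` lies.

Exponents may be infinite (a diverging interference, or an interferer at the receiver), so the
exponential is taken on `[0, ∞]`, with `e^{-∞} = 0`.
-/

/-! ### The exponential `e⁻ˣ` on `[0, ∞]` -/

/-- The function `x ↦ e⁻ˣ` on `[0, ∞]`, with values in `[0, 1]` and `e^{-∞} = 0`. -/
noncomputable def expNeg (x : ℝ≥0∞) : ℝ≥0∞ := EReal.exp (-(x : EReal))

/-- The function `y ↦ -log y`, truncated at `0` for `1 < y`; it inverts `expNeg` on `[0, 1]`. -/
noncomputable def negLog (y : ℝ≥0∞) : ℝ≥0∞ := (-ENNReal.log y).toENNReal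

@[simp] lemma expNeg_zero : expNeg 0 = 1 := by simp [expNeg]

@[simp] lemma expNeg_top : expNeg ∞ = 0 := by simp [expNeg]

lemma expNeg_add (x y : ℝ≥0∞) : expNeg (x + y) = expNeg x * expNeg y := by
  rw [expNeg, expNeg, expNeg, ← EReal.exp_add, EReal.coe_ennreal_add,
    EReal.neg_add (by simp) (by simp), sub_eq_add_neg]

lemma expNeg_sum {ι : Type*} (s : Finset ι) (f : ι → ℝ≥0∞) :
    expNeg (∑ i ∈ s, f i) = ∏ i ∈ s, expNeg (f i) := by
  classical
  induction s using Finset.induction_on with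
  | empty => simp
  | insert a s ha ih => rw [Finset.sum_insert ha, Finset.prod_insert ha, expNeg_add, ih]

lemma expNeg_mul_natCast (x : ℝ≥0∞) (n : ℕ) : expNeg (x * n) = expNeg x ^ n := by
  induction n with
  | zero => simp
  | succ n ih => rw [Nat.cast_succ, mul_add, mul_one, expNeg_add, ih, pow_succ]

lemma expNeg_antitone : Antitone expNeg := fun _ _ h ↦
  EReal.exp_monotone (EReal.neg_le_neg_iff.2 (EReal.coe_ennreal_le_coe_ennreal_iff.2 h))

lemma expNeg_le_one (x : ℝ≥0∞) : expNeg x ≤ 1 := expNeg_zero ▸ expNeg_antitone (zero_le (a := x))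

lemma expNeg_ne_top (x : ℝ≥0∞) : expNeg x ≠ ∞ := ((expNeg_le_one x).trans_lt ENNReal.one_lt_top).ne

lemma continuous_expNeg : Continuous expNeg :=
  ENNReal.continuous_exp.comp (continuous_neg.comp continuous_coe_ennreal_ereal)

@[fun_prop] lemma measurable_expNeg : Measurable expNeg := continuous_expNeg.measurable

lemma expNeg_ofReal {x : ℝ} (hx : 0 ≤ x) :
    expNeg (ENNReal.ofReal x) = ENNReal.ofReal (Real.exp (-x)) := by
  rw [expNeg, EReal.coe_ennreal_ofReal, max_eq_left hx, ← EReal.coe_neg, EReal.exp_coe]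

lemma expNeg_ofReal_mul {c : ℝ} (hc : 0 < c) (x : ℝ≥0∞) :
    expNeg (ENNReal.ofReal c * x) = expNeg x ^ c := by
  induction x with
  | top => simp [ENNReal.mul_top, hc]
  | coe x =>
    rw [← ENNReal.ofReal_coe_nnreal, ← ENNReal.ofReal_mul hc.le, expNeg_ofReal (by positivity),
      expNeg_ofReal (by positivity), ENNReal.ofReal_rpow_of_pos (Real.exp_pos _), ← Real.exp_mul]
    ring_nf

@[fun_prop] lemma measurable_negLog : Measurable negLog :=
  (ENNReal.measurable_log.neg).ereal_toENNReal

lemma expNeg_negLog {y : ℝ≥0∞} (hy : y ≤ 1) : expNeg (negLog y) = y := by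
  have h : 0 ≤ -ENNReal.log y := by
    rw [EReal.neg_nonneg]
    simpa using ENNReal.log_monotone hy
  rw [expNeg, negLog, EReal.coe_toENNReal h, neg_neg, ENNReal.exp_log]

/-! ### The Laplace functional of a Poisson point process -/

lemma lintegral_poissonMeasure_pow (r : ℝ≥0) (z : ℝ≥0∞) (hz : z ≤ 1) :
    ∫⁻ n, z ^ n ∂(poissonMeasure r) = expNeg (r * (1 - z)) := by
  lift z to ℝ≥0 using (hz.trans_lt ENNReal.one_lt_top).ne
  have hz' : (z : ℝ) ≤ 1 := by exact_mod_cast hz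
  have hsum : HasSum (fun n : ℕ ↦ Real.exp (-r) * r ^ n / n.factorial * z ^ n)
      (Real.exp (-(r * (1 - z)))) := by
    have h := (NormedSpace.expSeries_div_hasSum_exp ((r : ℝ) * z)).mul_left (Real.exp (-r))
    rw [← Real.exp_eq_exp_ℝ, ← Real.exp_add] at h
    convert! h using 1
    · ext n; rw [mul_pow]; ring
    · ring_nf
  have h1 : (r : ℝ≥0∞) * (1 - z) = ENNReal.ofReal (r * (1 - z)) := by
    rw [ENNReal.ofReal_mul r.coe_nonneg, ENNReal.ofReal_coe_nnreal,
      ENNReal.ofReal_sub _ z.coe_nonneg, ENNReal.ofReal_one, ENNReal.ofReal_coe_nnreal]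
  rw [h1, expNeg_ofReal (mul_nonneg r.coe_nonneg (sub_nonneg.2 hz')), ← hsum.tsum_eq,
    ENNReal.ofReal_tsum_of_nonneg (fun n ↦ by positivity) hsum.summable, poissonMeasure,
    lintegral_sum_measure]
  refine tsum_congr fun n ↦ ?_
  rw [lintegral_smul_measure, lintegral_dirac, smul_eq_mul, ENNReal.ofReal_mul (by positivity),
    ENNReal.ofReal_pow z.coe_nonneg, ENNReal.ofReal_coe_nnreal]

lemma measurable_countingMeasure {Ω : Type*} [MeasurableSpace Ω] {X : ℕ → Ω → Plane}
    (hX : ∀ i, Measurable (X i)) : Measurable (countingMeasure X) := by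
  refine Measure.measurable_of_measurable_coe _ fun s hs ↦ ?_
  have : (fun ω ↦ countingMeasure X ω s) = fun ω ↦ ∑' i, s.indicator 1 (X i ω) := by
    ext ω
    rw [countingMeasure, Measure.sum_apply _ hs]
    exact tsum_congr fun i ↦ Measure.dirac_apply' _ hs
  rw [this]
  exact Measurable.tsum fun i ↦ (measurable_const.indicator hs).comp (hX i)

lemma lintegral_countingMeasure {Ω : Type*} (X : ℕ → Ω → Plane) (ω : Ω) (f : Plane → ℝ≥0∞) :
    ∫⁻ x, f x ∂(countingMeasure X ω) = ∑' i, f (X i ω) := by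
  simp [countingMeasure, lintegral_sum_measure]

namespace IsHomogeneousPPP

variable {Ω : Type*} [MeasurableSpace Ω] {μ : Measure Ω} [IsProbabilityMeasure μ] {lam : ℝ}
  {X : ℕ → Ω → Plane}

lemma lintegral_expNeg_mul_count (h : IsHomogeneousPPP μ lam X) (y : ℝ≥0∞) {A : Set Plane}
    (hA : MeasurableSet A) (hfin : y ≠ 0 → volume A ≠ ∞) :
    ∫⁻ ω, expNeg (y * countingMeasure X ω A) ∂μ
      = expNeg (ENNReal.ofReal lam * ((1 - expNeg y) * volume A)) := by
  rcases eq_or_ne y 0 with rfl | hy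
  · simp
  rw [(h.hasLaw_count A hA (hfin hy)).lintegral_comp (f := fun z ↦ expNeg (y * z)) (by fun_prop),
    lintegral_map (by fun_prop) .of_discrete]
  simp_rw [expNeg_mul_natCast]
  rw [lintegral_poissonMeasure_pow _ _ (expNeg_le_one y), ENNReal.coe_mul,
    ENNReal.coe_toNNReal (hfin hy), mul_comm (1 - expNeg y), mul_assoc]
  rfl

lemma lintegral_expNeg_lintegral_simpleFunc (hX : ∀ i, Measurable (X i))
    (h : IsHomogeneousPPP μ lam X) (f : SimpleFunc Plane ℝ≥0∞)
    (hf : ∀ y ≠ 0, volume (f ⁻¹' {y}) ≠ ∞) :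
    ∫⁻ ω, expNeg (∫⁻ x, f x ∂(countingMeasure X ω)) ∂μ
      = expNeg (ENNReal.ofReal lam * ∫⁻ x, (1 - expNeg (f x))) := by
  let v : Fin f.range.card → ℝ≥0∞ := fun k ↦ f.range.equivFin.symm k
  have hv : Function.Injective v := Subtype.val_injective.comp f.range.equivFin.symm.injective
  have hrange (F : ℝ≥0∞ → ℝ≥0∞) : ∑ y ∈ f.range, F y = ∑ k, F (v k) := by
    rw [← Finset.sum_coe_sort]
    exact (Equiv.sum_comp f.range.equivFin.symm fun y : f.range ↦ F y).symm
  have hind := h.indep_count _ (fun k ↦ f ⁻¹' {v k}) (fun k ↦ f.measurableSet_preimage _)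
    fun k l hkl ↦ Disjoint.preimage _ (by simpa using hv.ne hkl)
  have hind' := hind.comp (fun k z ↦ expNeg (v k * z)) fun k ↦ by fun_prop
  have hmeas (k) : Measurable fun ω ↦ countingMeasure X ω (f ⁻¹' {v k}) :=
    (Measure.measurable_coe (f.measurableSet_preimage _)).comp (measurable_countingMeasure hX)
  have hR : ∫⁻ x, (1 - expNeg (f x)) = ∑ k, (1 - expNeg (v k)) * volume (f ⁻¹' {v k}) := by
    rw [← hrange fun y ↦ (1 - expNeg y) * volume (f ⁻¹' {y}), ← SimpleFunc.map_lintegral,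
      ← SimpleFunc.lintegral_eq_lintegral]
    rfl
  simp_rw [SimpleFunc.lintegral_eq_lintegral, SimpleFunc.lintegral, hrange, expNeg_sum]
  rw [hR, Finset.mul_sum, expNeg_sum]
  refine (lintegral_prod_eq_prod_lintegral_of_indepFun Finset.univ _ hind' fun k ↦
    (measurable_expNeg.comp ((hmeas k).const_mul _))).trans ?_
  exact Finset.prod_congr rfl fun k _ ↦
    h.lintegral_expNeg_mul_count _ (f.measurableSet_preimage _) (hf _)

/-- The Laplace functional of a homogeneous Poisson point process `Φ` of density `lam`:
`𝔼 exp (-∫ f dΦ) = exp (-lam ∫ (1 - e⁻ᶠ))`. -/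
theorem lintegral_expNeg_lintegral (hX : ∀ i, Measurable (X i))
    (h : IsHomogeneousPPP μ lam X) {f : Plane → ℝ≥0∞} (hf : Measurable f) :
    ∫⁻ ω, expNeg (∫⁻ x, f x ∂(countingMeasure X ω)) ∂μ
      = expNeg (ENNReal.ofReal lam * ∫⁻ x, (1 - expNeg (f x))) := by
  -- `f` is the increasing limit of simple functions supported in balls.
  let B : ℕ → Set Plane := fun n ↦ Metric.ball 0 n
  have hB (n) : MeasurableSet (B n) := measurableSet_ball
  let s : ℕ → SimpleFunc Plane ℝ≥0∞ := fun n ↦ (SimpleFunc.eapprox f n).restrict (B n)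
  have hs (n x) : s n x = (B n).indicator (SimpleFunc.eapprox f n) x :=
    SimpleFunc.restrict_apply _ (hB n) x
  have hmono (x) : Monotone fun n ↦ s n x := by
    intro m n hmn
    simp only [hs]
    refine (Set.indicator_le_indicator (SimpleFunc.monotone_eapprox f hmn x)).trans ?_
    exact Set.indicator_le_indicator_of_subset
      (Metric.ball_subset_ball (by exact_mod_cast hmn)) (fun _ ↦ zero_le) x
  have hlim (x) : Tendsto (fun n ↦ s n x) atTop (𝓝 (f x)) := by
    have h1 : Tendsto (fun n ↦ SimpleFunc.eapprox f n x) atTop (𝓝 (f x)) := by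
      rw [← SimpleFunc.iSup_eapprox_apply hf x]
      exact tendsto_atTop_iSup fun m n hmn ↦ SimpleFunc.monotone_eapprox f hmn x
    refine h1.congr' ?_
    obtain ⟨N, hN⟩ := exists_nat_gt ‖x‖
    filter_upwards [eventually_ge_atTop N] with n hn
    rw [hs, Set.indicator_of_mem]
    simpa [B] using hN.trans_le (by exact_mod_cast hn)
  have hstep (n) := lintegral_expNeg_lintegral_simpleFunc hX h (s n) fun y hy ↦ by
    refine ((measure_mono fun x hx ↦ ?_).trans_lt (measure_ball_lt_top (x := (0 : Plane))
      (r := n))).ne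
    by_contra hxn
    have : s n x = 0 := by rw [hs, Set.indicator_of_notMem hxn]
    exact hy (hx.symm.trans this)
  have hL : Tendsto (fun n ↦ ∫⁻ ω, expNeg (∫⁻ x, s n x ∂(countingMeasure X ω)) ∂μ) atTop
      (𝓝 (∫⁻ ω, expNeg (∫⁻ x, f x ∂(countingMeasure X ω)) ∂μ)) := by
    refine tendsto_lintegral_of_dominated_convergence (fun _ ↦ 1) (fun n ↦ ?_)
      (fun n ↦ ae_of_all _ fun ω ↦ expNeg_le_one _) (by simp) (ae_of_all _ fun ω ↦ ?_)
    · exact measurable_expNeg.comp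
        ((Measure.measurable_lintegral (s n).measurable).comp (measurable_countingMeasure hX))
    · exact (continuous_expNeg.tendsto _).comp (lintegral_tendsto_of_tendsto_of_monotone
        (fun n ↦ (s n).measurable.aemeasurable) (ae_of_all _ hmono) (ae_of_all _ hlim))
  have hR : Tendsto (fun n ↦ expNeg (ENNReal.ofReal lam * ∫⁻ x, (1 - expNeg (s n x)))) atTop
      (𝓝 (expNeg (ENNReal.ofReal lam * ∫⁻ x, (1 - expNeg (f x))))) := by
    refine (continuous_expNeg.tendsto _).comp (ENNReal.Tendsto.const_mul
      (lintegral_tendsto_of_tendsto_of_monotone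
        (fun n ↦ (measurable_const.sub (measurable_expNeg.comp (s n).measurable)).aemeasurable)
        (ae_of_all _ fun x m n hmn ↦ tsub_le_tsub_left (expNeg_antitone (hmono x hmn)) 1)
        (ae_of_all _ fun x ↦ ENNReal.Tendsto.sub tendsto_const_nhds
          ((continuous_expNeg.tendsto _).comp (hlim x)) (by simp))) (by simp))
  exact tendsto_nhds_unique hL (hR.congr fun n ↦ (hstep n).symm)

end IsHomogeneousPPP

/-! ### Exponential random variables -/

lemma expMeasure_one_lt_ofReal (t : ℝ≥0∞) :
    expMeasure 1 {x | t < ENNReal.ofReal x} = expNeg t := by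
  have := isProbabilityMeasure_expMeasure one_pos
  induction t with
  | top => simp
  | coe t =>
    have h1 : {x : ℝ | (t : ℝ≥0∞) < ENNReal.ofReal x} = (Set.Iic (t : ℝ))ᶜ := by
      ext x
      simp [← ENNReal.ofReal_coe_nnreal, ENNReal.ofReal_lt_ofReal_iff_of_nonneg]
    have h2 : (expMeasure 1).real (Set.Iic (t : ℝ)) = 1 - Real.exp (-t) := by
      rw [← cdf_eq_real, cdf_expMeasure_eq one_pos, if_pos t.coe_nonneg, one_mul]
    rw [h1, ← ofReal_measureReal, probReal_compl_eq_one_sub measurableSet_Iic, h2,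
      ← ENNReal.ofReal_coe_nnreal, expNeg_ofReal t.coe_nonneg, sub_sub_cancel]

lemma lintegral_expNeg_mul_expMeasure_one (w : ℝ≥0∞) :
    ∫⁻ x, expNeg (ENNReal.ofReal x * w) ∂(expMeasure 1) = (1 + w)⁻¹ := by
  induction w with
  | top =>
    have h : ∀ᵐ x ∂(expMeasure 1), expNeg (ENNReal.ofReal x * ∞) = 0 := by
      have h0 : ∀ᵐ x ∂(expMeasure 1), 0 < ENNReal.ofReal x := by
        have := isProbabilityMeasure_expMeasure one_pos
        rw [Filter.Eventually, mem_ae_iff_prob_eq_one (measurableSet_lt measurable_const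
          ENNReal.measurable_ofReal), expMeasure_one_lt_ofReal, expNeg_zero]
      filter_upwards [h0] with x hx
      rw [ENNReal.mul_top hx.ne', expNeg_top]
    simp [lintegral_congr_ae h]
  | coe w =>
    have hr : 0 < 1 + (w : ℝ) := by positivity
    -- Tilting the exponential density by `e^{-wx}` gives `(1 + w)⁻¹` times the density of rate
    -- `1 + w`.
    have h (x : ℝ) : exponentialPDF 1 x * expNeg (ENNReal.ofReal x * w)
        = ENNReal.ofReal (1 + w)⁻¹ * exponentialPDF (1 + w) x := by
      rcases lt_or_ge x 0 with hx | hx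
      · simp [exponentialPDF_of_neg hx]
      · rw [exponentialPDF_of_nonneg hx, exponentialPDF_of_nonneg hx, ← ENNReal.ofReal_coe_nnreal,
          ← ENNReal.ofReal_mul hx, expNeg_ofReal (by positivity), ← ENNReal.ofReal_mul (by positivity),
          ← ENNReal.ofReal_mul (by positivity), inv_mul_cancel_left₀ hr.ne', one_mul,
          ← Real.exp_add]
        ring_nf
    have hm : Measurable (exponentialPDF 1) :=
      ENNReal.measurable_ofReal.comp (measurable_exponentialPDFReal 1)
    change ∫⁻ x, _ ∂(volume.withDensity (exponentialPDF 1)) = _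
    rw [lintegral_withDensity_eq_lintegral_mul _ hm (by fun_prop)]
    simp_rw [Pi.mul_apply, h]
    have hm' : Measurable (exponentialPDF (1 + w)) :=
      ENNReal.measurable_ofReal.comp (measurable_exponentialPDFReal _)
    rw [lintegral_const_mul _ hm',
      lintegral_exponentialPDF_eq_one hr, mul_one, ENNReal.ofReal_inv_of_pos hr,
      ENNReal.ofReal_add zero_le_one w.coe_nonneg, ENNReal.ofReal_one, ENNReal.ofReal_coe_nnreal]

lemma ProbabilityTheory.IndepFun.lintegral_comp_prodMk {Ω α β : Type*} [MeasurableSpace Ω]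
    [MeasurableSpace α] [MeasurableSpace β] {μ : Measure Ω} [IsProbabilityMeasure μ]
    {X : Ω → α} {Y : Ω → β} (h : IndepFun X Y μ) (hX : Measurable X) (hY : Measurable Y)
    {F : α × β → ℝ≥0∞} (hF : Measurable F) :
    ∫⁻ ω, F (X ω, Y ω) ∂μ = ∫⁻ ω, ∫⁻ ω', F (X ω, Y ω') ∂μ ∂μ := by
  have : IsProbabilityMeasure (μ.map Y) := Measure.isProbabilityMeasure_map hY.aemeasurable
  rw [← lintegral_map hF (hX.prodMk hY),
    (indepFun_iff_map_prod_eq_prod_map_map hX.aemeasurable hY.aemeasurable).1 h,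
    lintegral_prod _ hF.aemeasurable, lintegral_map hF.lintegral_prod_right' hX]
  refine lintegral_congr fun ω ↦ ?_
  rw [lintegral_map (by fun_prop) hY]

/-! ### The conditional success probability -/

/-- The factor by which an interferer multiplies the conditional success probability, given its
relative path loss `w`: the Laplace transform at `w` of the product of an access indicator of mean
`p` and a unit-mean exponential gain. -/
noncomputable def linkFactor (p : ℝ) (w : ℝ≥0∞) : ℝ≥0∞ :=
  ENNReal.ofReal p * (1 + w)⁻¹ + ENNReal.ofReal (1 - p)

@[fun_prop] lemma measurable_linkFactor (p : ℝ) : Measurable (linkFactor p) := by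
  unfold linkFactor; fun_prop

lemma ofReal_add_ofReal_one_sub {p : ℝ} (hp : p ∈ Set.Ioc (0 : ℝ) 1) :
    ENNReal.ofReal p + ENNReal.ofReal (1 - p) = 1 := by
  rw [← ENNReal.ofReal_add hp.1.le (sub_nonneg.2 hp.2), add_sub_cancel, ENNReal.ofReal_one]

lemma one_add_inv_le_one (w : ℝ≥0∞) : (1 + w)⁻¹ ≤ 1 := ENNReal.inv_le_one.2 le_self_add

lemma linkFactor_le_one {p : ℝ} (hp : p ∈ Set.Ioc (0 : ℝ) 1) (w : ℝ≥0∞) : linkFactor p w ≤ 1 := by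
  rw [← ofReal_add_ofReal_one_sub hp, linkFactor]
  gcongr
  exact mul_le_of_le_one_right zero_le (one_add_inv_le_one w)

namespace BipolarNetwork

variable {Ω : Type*} [MeasurableSpace Ω] (N : BipolarNetwork Ω) {μ : Measure Ω} {lam p : ℝ}

/-- The interference relative to the mean received power of the desired link, times the
threshold, when the relative path loss of the `i`-th interferer is `w i`. -/
noncomputable def weightedInterference (w : ℕ → ℝ≥0∞) (b : ℕ → Bool) (h : ℕ → ℝ) : ℝ≥0∞ :=
  ∑' i, if b i = true then ENNReal.ofReal (h i) * w i else 0

lemma measurable_weightedInterference :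
    Measurable fun q : (ℕ → ℝ≥0∞) × (ℕ → Bool) × (ℕ → ℝ) ↦
      weightedInterference q.1 q.2.1 q.2.2 := by
  refine Measurable.tsum fun i ↦ Measurable.ite ?_ (by fun_prop) measurable_const
  exact (measurableSet_singleton true).preimage
    (f := fun q : (ℕ → ℝ≥0∞) × (ℕ → Bool) × (ℕ → ℝ) ↦ q.2.1 i) (by fun_prop)

/-- The path loss of an interferer at `x` relative to that of the desired link, times the SIR
threshold. -/
noncomputable def relPathLoss (α R θ : ℝ) (x : Plane) : ℝ≥0∞ :=
  ENNReal.ofReal θ * pathLoss α x / pathLoss α !₂[R, 0]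

@[fun_prop] lemma measurable_relPathLoss (α R θ : ℝ) : Measurable (relPathLoss α R θ) := by
  unfold relPathLoss pathLoss; fun_prop

/-- The function `exp (∑ x ∈ Φ, log (linkFactor p (w x)))` of the point process `Φ`, where `w x` is
the relative path loss: a version of the conditional success probability. -/
noncomputable def successProduct (N : BipolarNetwork Ω) (p α R θ : ℝ) (ω : Ω) : ℝ≥0∞ :=
  expNeg (∫⁻ x, negLog (linkFactor p (relPathLoss α R θ x)) ∂(countingMeasure N.X ω))

lemma successProduct_le_one (p α R θ : ℝ) (ω : Ω) : N.successProduct p α R θ ω ≤ 1 :=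
  expNeg_le_one _

lemma successProduct_ne_top (p α R θ : ℝ) (ω : Ω) : N.successProduct p α R θ ω ≠ ∞ :=
  expNeg_ne_top _

lemma measurable_successProduct_sigmaPhi (p α R θ : ℝ) :
    Measurable[N.sigmaPhi] (N.successProduct p α R θ) :=
  (measurable_expNeg.comp (Measure.measurable_lintegral (by fun_prop))).comp
    (comap_measurable (countingMeasure N.X))

lemma sigmaPhi_le : N.sigmaPhi ≤ ‹MeasurableSpace Ω› :=
  (measurable_countingMeasure N.measurable_X).comap_le

lemma measurable_successProduct (p α R θ : ℝ) : Measurable (N.successProduct p α R θ) :=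
  (N.measurable_successProduct_sigmaPhi p α R θ).mono N.sigmaPhi_le le_rfl

lemma measurableSet_successEvent (α R θ : ℝ) : MeasurableSet (N.successEvent α R θ) := by
  have hg := N.measurable_g
  have hI : Measurable (N.interference α) := by
    refine Measurable.tsum fun i ↦ Measurable.ite
      (N.measurable_active i (measurableSet_singleton true)) ?_ measurable_const
    have := N.measurable_h i
    have := N.measurable_X i
    unfold pathLoss
    fun_prop
  refine measurableSet_lt measurable_const ?_
  unfold sir
  fun_prop

namespace IsPoissonAlohaRayleigh

variable {N}

/-- Almost surely, the success event `SIR > θ` says that the gain of the desired link exceeds the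
weighted interference. -/
lemma mem_successEvent_iff (hN : N.IsPoissonAlohaRayleigh μ lam p) (α : ℝ) {R : ℝ} (hR : 0 < R)
    {θ : ℝ} (hθ : 0 < θ) :
    ∀ᵐ ω ∂μ, ω ∈ N.successEvent α R θ ↔ weightedInterference
      (fun i ↦ relPathLoss α R θ (N.X i ω)) (fun i ↦ N.active i ω) (fun i ↦ N.h i ω)
        < ENNReal.ofReal (N.g ω) := by
  have hg : ∀ᵐ ω ∂μ, 0 < ENNReal.ofReal (N.g ω) := by
    have hm : MeasurableSet {x : ℝ | 0 < ENNReal.ofReal x} :=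
      measurableSet_lt measurable_const ENNReal.measurable_ofReal
    have := isProbabilityMeasure_expMeasure one_pos
    rw [hN.hasLaw_g.ae_iff (p := fun x ↦ 0 < ENNReal.ofReal x) (measurable_mem.2 hm),
      Filter.Eventually, mem_ae_iff_prob_eq_one hm, expMeasure_one_lt_ofReal, expNeg_zero]
  have hne : (!₂[R, 0] : Plane) ≠ 0 := fun h ↦ hR.ne' (by simpa using congrArg (fun x ↦ x 0) h)
  have h0 : pathLoss α !₂[R, 0] ≠ 0 := by
    rw [pathLoss, Ne, ENNReal.rpow_eq_zero_iff]
    simp [hne]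
  have ht : pathLoss α !₂[R, 0] ≠ ∞ := by
    rw [pathLoss, Ne, ENNReal.rpow_eq_top_iff]
    simp [hne]
  filter_upwards [hg] with ω hω
  have hI : weightedInterference
      (fun i ↦ relPathLoss α R θ (N.X i ω)) (fun i ↦ N.active i ω) (fun i ↦ N.h i ω)
      = ENNReal.ofReal θ * N.interference α ω / pathLoss α !₂[R, 0] := by
    rw [weightedInterference, interference, ← ENNReal.tsum_mul_left, div_eq_mul_inv,
      ← ENNReal.tsum_mul_right]
    refine tsum_congr fun i ↦ ?_
    split_ifs
    · rw [relPathLoss, div_eq_mul_inv]; ring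
    · simp
  rw [hI, ENNReal.div_lt_iff (.inl h0) (.inl ht)]
  exact ENNReal.lt_div_iff_mul_lt (.inr ENNReal.ofReal_ne_top) (.inr (ENNReal.ofReal_pos.2 hθ).ne')

variable [IsProbabilityMeasure μ]

lemma lintegral_ite_active (hN : N.IsPoissonAlohaRayleigh μ lam p) (hp : p ∈ Set.Ioc (0 : ℝ) 1)
    (w : ℝ≥0∞) (i : ℕ) :
    ∫⁻ ω, (if N.active i ω = true then (1 + w)⁻¹ else 1) ∂μ = linkFactor p w := by
  have hm : MeasurableSet {ω | N.active i ω = true} :=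
    N.measurable_active i (measurableSet_singleton true)
  have hc : μ {ω | N.active i ω = true}ᶜ = ENNReal.ofReal (1 - p) := by
    rw [prob_compl_eq_one_sub hm, hN.prob_active, ENNReal.ofReal_sub _ hp.1.le, ENNReal.ofReal_one]
  have h1 : ∫⁻ ω in {ω | N.active i ω = true}, (if N.active i ω = true then (1 + w)⁻¹ else 1) ∂μ
      = ∫⁻ ω in {ω | N.active i ω = true}, (1 + w)⁻¹ ∂μ :=
    setLIntegral_congr_fun hm fun ω hω ↦ if_pos hω
  have h2 : ∫⁻ ω in {ω | N.active i ω = true}ᶜ, (if N.active i ω = true then (1 + w)⁻¹ else 1) ∂μ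
      = ∫⁻ ω in {ω | N.active i ω = true}ᶜ, 1 ∂μ :=
    setLIntegral_congr_fun hm.compl fun ω hω ↦ if_neg hω
  rw [← lintegral_add_compl _ hm, h1, h2, setLIntegral_const, setLIntegral_const, hc,
    hN.prob_active, linkFactor, one_mul, mul_comm]

lemma lintegral_expNeg_sum_range (hN : N.IsPoissonAlohaRayleigh μ lam p)
    (hp : p ∈ Set.Ioc (0 : ℝ) 1) (w : ℕ → ℝ≥0∞) (n : ℕ) :
    ∫⁻ ω, expNeg (∑ i ∈ Finset.range n,
        if N.active i ω = true then ENNReal.ofReal (N.h i ω) * w i else 0) ∂μ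
      = ∏ i ∈ Finset.range n, linkFactor p (w i) := by
  have hA : Measurable fun ω i ↦ N.active i ω := measurable_pi_lambda _ N.measurable_active
  have hH : Measurable fun ω i ↦ N.h i ω := measurable_pi_lambda _ N.measurable_h
  -- Average over the gains first, then over the access decisions.
  have hF : Measurable fun q : (ℕ → Bool) × (ℕ → ℝ) ↦ expNeg (∑ i ∈ Finset.range n,
      if q.1 i = true then ENNReal.ofReal (q.2 i) * w i else 0) := by
    refine measurable_expNeg.comp (Finset.measurable_sum _ fun i _ ↦
      Measurable.ite ?_ (by fun_prop) measurable_const)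
    exact (measurableSet_singleton true).preimage
      (f := fun q : (ℕ → Bool) × (ℕ → ℝ) ↦ q.1 i) (by fun_prop)
  rw [hN.indep_active_h.lintegral_comp_prodMk hA hH hF]
  have inner (b : ℕ → Bool) : ∫⁻ ω, expNeg (∑ i ∈ Finset.range n,
      if b i = true then ENNReal.ofReal (N.h i ω) * w i else 0) ∂μ
      = ∏ i ∈ Finset.range n, if b i = true then (1 + w i)⁻¹ else 1 := by
    simp_rw [expNeg_sum]
    have hφ (i : ℕ) : Measurable fun x : ℝ ↦
        expNeg (if b i = true then ENNReal.ofReal x * w i else 0) := by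
      split_ifs <;> fun_prop
    refine (lintegral_prod_eq_prod_lintegral_of_indepFun _ _ (hN.iIndep_h.comp _ hφ)
      fun i ↦ (hφ i).comp (N.measurable_h i)).trans (Finset.prod_congr rfl fun i _ ↦ ?_)
    refine ((hN.hasLaw_h i).lintegral_comp (hφ i).aemeasurable).trans ?_
    split_ifs
    · exact lintegral_expNeg_mul_expMeasure_one _
    · have := isProbabilityMeasure_expMeasure one_pos
      simp
  simp_rw [inner]
  have hψ (i : ℕ) : Measurable fun b : Bool ↦ if b = true then (1 + w i)⁻¹ else 1 := .of_discrete
  exact (lintegral_prod_eq_prod_lintegral_of_indepFun _ _ (hN.iIndep_active.comp _ hψ)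
    fun i ↦ (hψ i).comp (N.measurable_active i)).trans
      (Finset.prod_congr rfl fun i _ ↦ hN.lintegral_ite_active hp (w i) i)

lemma lintegral_expNeg_weightedInterference (hN : N.IsPoissonAlohaRayleigh μ lam p)
    (hp : p ∈ Set.Ioc (0 : ℝ) 1) (w : ℕ → ℝ≥0∞) :
    ∫⁻ ω, expNeg (weightedInterference w (fun i ↦ N.active i ω) fun i ↦ N.h i ω) ∂μ
      = expNeg (∑' i, negLog (linkFactor p (w i))) := by
  have hL : Tendsto (fun n ↦ ∫⁻ ω, expNeg (∑ i ∈ Finset.range n,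
      if N.active i ω = true then ENNReal.ofReal (N.h i ω) * w i else 0) ∂μ) atTop
      (𝓝 (∫⁻ ω, expNeg (weightedInterference w (fun i ↦ N.active i ω) fun i ↦ N.h i ω) ∂μ)) := by
    refine tendsto_lintegral_of_dominated_convergence (fun _ ↦ 1) (fun n ↦ ?_)
      (fun n ↦ ae_of_all _ fun ω ↦ expNeg_le_one _) (by simp) (ae_of_all _ fun ω ↦
        (continuous_expNeg.tendsto _).comp (ENNReal.tendsto_nat_tsum _))
    refine measurable_expNeg.comp (Finset.measurable_sum _ fun i _ ↦ Measurable.ite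
      (N.measurable_active i (measurableSet_singleton true)) ?_ measurable_const)
    have := N.measurable_h i
    fun_prop
  have hR : Tendsto (fun n ↦ ∏ i ∈ Finset.range n, linkFactor p (w i)) atTop
      (𝓝 (expNeg (∑' i, negLog (linkFactor p (w i))))) := by
    refine ((continuous_expNeg.tendsto _).comp (ENNReal.tendsto_nat_tsum _)).congr fun n ↦ ?_
    rw [Function.comp_apply, expNeg_sum]
    exact Finset.prod_congr rfl fun i _ ↦ expNeg_negLog (linkFactor_le_one hp _)
  exact tendsto_nhds_unique hL (hR.congr fun n ↦ (hN.lintegral_expNeg_sum_range hp w n).symm)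

lemma measure_weightedInterference_lt (hN : N.IsPoissonAlohaRayleigh μ lam p)
    (hp : p ∈ Set.Ioc (0 : ℝ) 1) (w : ℕ → ℝ≥0∞) :
    μ {ω | weightedInterference w (fun i ↦ N.active i ω) (fun i ↦ N.h i ω)
        < ENNReal.ofReal (N.g ω)} = expNeg (∑' i, negLog (linkFactor p (w i))) := by
  have hA : Measurable fun ω i ↦ N.active i ω := measurable_pi_lambda _ N.measurable_active
  have hH : Measurable fun ω i ↦ N.h i ω := measurable_pi_lambda _ N.measurable_h
  have hwI : Measurable fun q : (ℕ → Bool) × (ℕ → ℝ) ↦ weightedInterference w q.1 q.2 :=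
    measurable_weightedInterference.comp (measurable_const.prodMk measurable_id)
  let T : Set (((ℕ → Bool) × (ℕ → ℝ)) × ℝ) :=
    {q | weightedInterference w q.1.1 q.1.2 < ENNReal.ofReal q.2}
  have hT : MeasurableSet T := measurableSet_lt (hwI.comp measurable_fst) (by fun_prop)
  have h1 : ∫⁻ ω, T.indicator 1 (((fun i ↦ N.active i ω), fun i ↦ N.h i ω), N.g ω) ∂μ
      = μ {ω | weightedInterference w (fun i ↦ N.active i ω) (fun i ↦ N.h i ω)
        < ENNReal.ofReal (N.g ω)} :=
    lintegral_indicator_one (((hA.prodMk hH).prodMk N.measurable_g) hT)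
  rw [← h1, hN.indep_g.symm.lintegral_comp_prodMk (hA.prodMk hH) N.measurable_g
    (measurable_one.indicator hT), ← hN.lintegral_expNeg_weightedInterference hp w]
  refine lintegral_congr fun ω ↦ ?_
  have hm : MeasurableSet {x | weightedInterference w (fun i ↦ N.active i ω) (fun i ↦ N.h i ω)
      < ENNReal.ofReal x} := measurableSet_lt measurable_const ENNReal.measurable_ofReal
  refine (lintegral_indicator_one (N.measurable_g hm)).trans ?_
  rw [← expMeasure_one_lt_ofReal, ← hN.hasLaw_g.map_eq, Measure.map_apply N.measurable_g hm]

/-- Given the point process `Φ`, the link succeeds with probability `successProduct`: this identity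
integrates the conditional success probability over an event on the locations. -/
lemma measure_inter_successEvent (hN : N.IsPoissonAlohaRayleigh μ lam p)
    (hp : p ∈ Set.Ioc (0 : ℝ) 1) (α : ℝ) {R : ℝ} (hR : 0 < R) {θ : ℝ} (hθ : 0 < θ)
    {S : Set (Measure Plane)} (hS : MeasurableSet S) :
    μ (countingMeasure N.X ⁻¹' S ∩ N.successEvent α R θ)
      = ∫⁻ ω in countingMeasure N.X ⁻¹' S, N.successProduct p α R θ ω ∂μ := by
  have hX : Measurable fun ω i ↦ N.X i ω := measurable_pi_lambda _ N.measurable_X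
  have hrest : Measurable fun ω ↦ (N.g ω, (fun i ↦ N.active i ω), fun i ↦ N.h i ω) :=
    N.measurable_g.prodMk ((measurable_pi_lambda _ N.measurable_active).prodMk
      (measurable_pi_lambda _ N.measurable_h))
  have hΦ := measurable_countingMeasure N.measurable_X
  let S' : Set (ℕ → Plane) := countingMeasure (fun i x ↦ x i) ⁻¹' S
  have hS' : MeasurableSet S' := measurable_countingMeasure (fun i ↦ measurable_pi_apply i) hS
  let T : Set ((ℕ → Plane) × ℝ × (ℕ → Bool) × (ℕ → ℝ)) :=
    {q | q.1 ∈ S' ∧ weightedInterference (fun i ↦ relPathLoss α R θ (q.1 i)) q.2.2.1 q.2.2.2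
      < ENNReal.ofReal q.2.1}
  have hT : MeasurableSet T := by
    have hw := measurable_weightedInterference.comp
      (f := fun q : (ℕ → Plane) × ℝ × (ℕ → Bool) × (ℕ → ℝ) ↦
        ((fun i ↦ relPathLoss α R θ (q.1 i)), q.2.2.1, q.2.2.2)) (by fun_prop)
    have hg : Measurable fun q : (ℕ → Plane) × ℝ × (ℕ → Bool) × (ℕ → ℝ) ↦
      ENNReal.ofReal q.2.1 := by fun_prop
    exact (measurable_fst hS').inter (measurableSet_lt hw hg)
  have h1 : μ (countingMeasure N.X ⁻¹' S ∩ N.successEvent α R θ)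
      = ∫⁻ ω, T.indicator 1 ((fun i ↦ N.X i ω), N.g ω, (fun i ↦ N.active i ω), fun i ↦ N.h i ω)
        ∂μ := by
    refine Eq.trans ?_ (lintegral_indicator_one ((hX.prodMk hrest) hT)).symm
    refine measure_congr ?_
    filter_upwards [hN.mem_successEvent_iff α hR hθ] with ω hω
    exact propext (and_congr Iff.rfl hω)
  rw [h1, hN.indep_X.lintegral_comp_prodMk hX hrest (measurable_one.indicator hT),
    ← lintegral_indicator (hΦ hS)]
  refine lintegral_congr fun ω ↦ ?_
  by_cases hω : countingMeasure N.X ω ∈ S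
  · rw [Set.indicator_of_mem (by exact hω), successProduct, lintegral_countingMeasure,
      ← hN.measure_weightedInterference_lt hp]
    have hm : MeasurableSet {ω' | ((fun i ↦ N.X i ω), N.g ω', (fun i ↦ N.active i ω'),
        fun i ↦ N.h i ω') ∈ T} := (measurable_const.prodMk hrest) hT
    refine (lintegral_indicator_one hm).trans (congrArg μ ?_)
    ext ω'
    exact and_iff_right (show (fun i ↦ N.X i ω) ∈ S' from hω)
  · rw [Set.indicator_of_notMem (by exact hω), lintegral_eq_zero_of_ae_eq_zero]
    refine ae_of_all _ fun ω' ↦ Set.indicator_of_notMem (fun h ↦ hω h.1) _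

lemma condSuccess_ae_eq (hN : N.IsPoissonAlohaRayleigh μ lam p) (hp : p ∈ Set.Ioc (0 : ℝ) 1)
    (α : ℝ) {R : ℝ} (hR : 0 < R) {θ : ℝ} (hθ : 0 < θ) :
    N.condSuccess μ α R θ =ᵐ[μ] fun ω ↦ (N.successProduct p α R θ ω).toReal := by
  have hE := N.measurableSet_successEvent α R θ
  have hint : Integrable (fun ω ↦ (N.successProduct p α R θ ω).toReal) μ :=
    integrable_toReal_of_lintegral_ne_top (N.measurable_successProduct _ _ _ _).aemeasurable
      (((lintegral_mono fun ω ↦ N.successProduct_le_one p α R θ ω).trans_lt (by simp)).ne)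
  refine (ae_eq_condExp_of_forall_setIntegral_eq N.sigmaPhi_le
    ((integrable_const (1 : ℝ)).indicator hE) (fun s _ _ ↦ hint.integrableOn) ?_
    (N.measurable_successProduct_sigmaPhi p α R θ).ennreal_toReal.aestronglyMeasurable).symm
  rintro _ ⟨S, hS, rfl⟩ -
  rw [integral_toReal (N.measurable_successProduct _ _ _ _).aemeasurable
    (ae_of_all _ fun ω ↦ (N.successProduct_ne_top p α R θ ω).lt_top),
    setIntegral_indicator hE, setIntegral_const, smul_eq_mul, mul_one, measureReal_def,
    hN.measure_inter_successEvent hp α hR hθ hS]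

lemma measure_successEvent (hN : N.IsPoissonAlohaRayleigh μ lam p) (hp : p ∈ Set.Ioc (0 : ℝ) 1)
    (α : ℝ) {R : ℝ} (hR : 0 < R) {θ : ℝ} (hθ : 0 < θ) :
    μ (N.successEvent α R θ) = ∫⁻ ω, N.successProduct p α R θ ω ∂μ := by
  simpa using hN.measure_inter_successEvent hp α hR hθ MeasurableSet.univ

end IsPoissonAlohaRayleigh
end BipolarNetwork

/-! ### The first two moments of the conditional success probability -/

lemma one_sub_linkFactor {p : ℝ} (hp : p ∈ Set.Ioc (0 : ℝ) 1) (w : ℝ≥0∞) :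
    1 - linkFactor p w = ENNReal.ofReal p * (1 - (1 + w)⁻¹) := by
  rw [linkFactor, ENNReal.mul_sub (by simp), mul_one, ← ofReal_add_ofReal_one_sub hp,
    ENNReal.add_sub_add_eq_sub_right ENNReal.ofReal_ne_top]

/-- Writing `v = 1 - (1 + w)⁻¹ ≤ 1`, this is `1 - (1 - p v)² = p (2 v - p v²) ≥ p (2 - p) v`. -/
lemma le_one_sub_linkFactor_mul_self {p : ℝ} (hp : p ∈ Set.Ioc (0 : ℝ) 1) (w : ℝ≥0∞) :
    ENNReal.ofReal (p * (2 - p)) * (1 - (1 + w)⁻¹) ≤ 1 - linkFactor p w * linkFactor p w := by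
  obtain ⟨q, hq⟩ : ∃ q : ℝ≥0, (1 + w)⁻¹ = q :=
    ⟨_, (ENNReal.coe_toNNReal ((one_add_inv_le_one w).trans_lt ENNReal.one_lt_top).ne).symm⟩
  have hq1 : (q : ℝ) ≤ 1 := by exact_mod_cast hq ▸ one_add_inv_le_one w
  have hq0 : 0 ≤ (q : ℝ) := q.coe_nonneg
  obtain ⟨hp0, hp1⟩ := hp
  have hm : 0 ≤ p * q + (1 - p) := add_nonneg (mul_nonneg hp0.le hq0) (sub_nonneg.2 hp1)
  rw [linkFactor, hq, ← ENNReal.ofReal_coe_nnreal, ← ENNReal.ofReal_mul hp0.le,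
    ← ENNReal.ofReal_add (mul_nonneg hp0.le hq0) (sub_nonneg.2 hp1), ← ENNReal.ofReal_mul hm,
    ← ENNReal.ofReal_one, ← ENNReal.ofReal_sub _ hq0, ← ENNReal.ofReal_sub _ (mul_nonneg hm hm),
    ← ENNReal.ofReal_mul (mul_nonneg hp0.le (by linarith))]
  refine ENNReal.ofReal_le_ofReal ?_
  nlinarith [mul_nonneg (mul_nonneg hp0.le hp0.le) (mul_nonneg hq0 (sub_nonneg.2 hq1))]

namespace BipolarNetwork

/-- The mean success probability `exp (-ν ∫ w / (1 + w))` as an explicit function of the density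
`ν` of active transmitters, where `w` is the relative path loss. -/
noncomputable def successLimit (α R θ ν : ℝ) : ℝ≥0∞ :=
  expNeg (ENNReal.ofReal ν * ∫⁻ x, (1 - (1 + relPathLoss α R θ x)⁻¹))

namespace IsPoissonAlohaRayleigh

variable {Ω : Type*} [MeasurableSpace Ω] {N : BipolarNetwork Ω} {μ : Measure Ω}
  [IsProbabilityMeasure μ] {ν p : ℝ}

lemma lintegral_successProduct (hN : N.IsPoissonAlohaRayleigh μ (ν / p) p)
    (hp : p ∈ Set.Ioc (0 : ℝ) 1) (α R θ : ℝ) :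
    ∫⁻ ω, N.successProduct p α R θ ω ∂μ = successLimit α R θ ν := by
  unfold successProduct
  rw [hN.ppp.lintegral_expNeg_lintegral N.measurable_X (by fun_prop), successLimit]
  simp_rw [expNeg_negLog (linkFactor_le_one hp _), one_sub_linkFactor hp]
  rw [lintegral_const_mul _ (by fun_prop), ← mul_assoc, ← ENNReal.ofReal_mul' hp.1.le,
    div_mul_cancel₀ _ hp.1.ne']

lemma lintegral_successProduct_sq_le (hN : N.IsPoissonAlohaRayleigh μ (ν / p) p)
    (hp : p ∈ Set.Ioc (0 : ℝ) 1) (α R θ : ℝ) :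
    ∫⁻ ω, N.successProduct p α R θ ω ^ 2 ∂μ ≤ successLimit α R θ ν ^ (2 - p) := by
  have hm : Measurable fun x ↦ negLog (linkFactor p (relPathLoss α R θ x)) := by fun_prop
  have h2p : 0 < 2 - p := by linarith [hp.2]
  simp_rw [successProduct, sq, ← expNeg_add, ← lintegral_add_left hm]
  rw [hN.ppp.lintegral_expNeg_lintegral N.measurable_X (f := fun x ↦ _ + _) (hm.add hm),
    successLimit, ← expNeg_ofReal_mul h2p]
  refine expNeg_antitone ?_
  simp_rw [expNeg_add, expNeg_negLog (linkFactor_le_one hp _)]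
  calc ENNReal.ofReal (2 - p) * (ENNReal.ofReal ν * ∫⁻ x, (1 - (1 + relPathLoss α R θ x)⁻¹))
      = ENNReal.ofReal (ν / p) * ∫⁻ x, ENNReal.ofReal (p * (2 - p)) *
          (1 - (1 + relPathLoss α R θ x)⁻¹) := by
        rw [lintegral_const_mul _ (by fun_prop), ← mul_assoc, ← mul_assoc,
          ← ENNReal.ofReal_mul h2p.le, ← ENNReal.ofReal_mul' (mul_nonneg hp.1.le h2p.le)]
        congr 2
        field_simp [hp.1.ne']
    _ ≤ _ := by
        gcongr with x
        exact le_one_sub_linkFactor_mul_self hp _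

lemma meanSuccess_eq (hN : N.IsPoissonAlohaRayleigh μ (ν / p) p) (hp : p ∈ Set.Ioc (0 : ℝ) 1)
    (α : ℝ) {R : ℝ} (hR : 0 < R) {θ : ℝ} (hθ : 0 < θ) :
    N.meanSuccess μ α R θ = (successLimit α R θ ν).toReal := by
  rw [meanSuccess, measureReal_def, hN.measure_successEvent hp α hR hθ,
    hN.lintegral_successProduct hp]

/-- Chebyshev's inequality for the conditional success probability. -/
lemma measureReal_le_abs_sub_le (hN : N.IsPoissonAlohaRayleigh μ (ν / p) p)
    (hp : p ∈ Set.Ioc (0 : ℝ) 1) (α : ℝ) {R : ℝ} (hR : 0 < R) {θ : ℝ} (hθ : 0 < θ)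
    {δ : ℝ} (hδ : 0 < δ) :
    μ.real {ω | δ ≤ |N.condSuccess μ α R θ ω - (successLimit α R θ ν).toReal|}
      ≤ ((successLimit α R θ ν).toReal ^ (2 - p) - (successLimit α R θ ν).toReal ^ 2) / δ ^ 2 := by
  set Z := N.successProduct p α R θ
  set s := successLimit α R θ ν
  have hs : s ≠ ∞ := expNeg_ne_top _
  have hZm : Measurable Z := N.measurable_successProduct p α R θ
  have hZt (ω) : Z ω ≠ ∞ := N.successProduct_ne_top p α R θ ω
  have hLp : MemLp (fun ω ↦ (Z ω).toReal) 2 μ := by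
    refine MemLp.of_bound hZm.ennreal_toReal.aestronglyMeasurable 1 (ae_of_all _ fun ω ↦ ?_)
    rw [Real.norm_of_nonneg ENNReal.toReal_nonneg]
    exact ENNReal.toReal_le_of_le_ofReal zero_le_one
      (by simpa using N.successProduct_le_one p α R θ ω)
  have hmean : ∫ ω, (Z ω).toReal ∂μ = s.toReal := by
    rw [integral_toReal hZm.aemeasurable (ae_of_all _ fun ω ↦ (hZt ω).lt_top),
      hN.lintegral_successProduct hp]
  have hsq : ∫ ω, (Z ω).toReal ^ 2 ∂μ ≤ s.toReal ^ (2 - p) := by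
    simp_rw [← ENNReal.toReal_pow]
    rw [integral_toReal (hZm.pow_const 2).aemeasurable
      (ae_of_all _ fun ω ↦ ENNReal.pow_lt_top (hZt ω).lt_top), ENNReal.toReal_rpow]
    exact ENNReal.toReal_mono (ENNReal.rpow_ne_top_of_nonneg (by linarith [hp.2]) hs)
      (hN.lintegral_successProduct_sq_le hp α R θ)
  have hvar : Var[fun ω ↦ (Z ω).toReal; μ] ≤ s.toReal ^ (2 - p) - s.toReal ^ 2 := by
    rw [variance_eq_sub hLp, hmean]
    exact sub_le_sub_right hsq _
  have hcheb := meas_ge_le_variance_div_sq hLp hδ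
  rw [hmean] at hcheb
  have hcongr : μ.real {ω | δ ≤ |N.condSuccess μ α R θ ω - s.toReal|}
      = μ.real {ω | δ ≤ |(Z ω).toReal - s.toReal|} := by
    refine measureReal_congr ?_
    filter_upwards [hN.condSuccess_ae_eq hp α hR hθ] with ω hω
    exact congrArg (fun y ↦ δ ≤ |y - s.toReal|) hω
  rw [hcongr]
  exact (ENNReal.toReal_le_of_le_ofReal
    (div_nonneg (variance_nonneg _ _) (sq_nonneg δ)) hcheb).trans (by gcongr)

end IsPoissonAlohaRayleigh
end BipolarNetwork

/-! ### The sparse limit -/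

/-- For every `p ∈ (0, 1]` let `N p` be a Poisson bipolar network of density `ν / p` with transmit
probability `p`. All these networks have the same mean success probability `ps`, and the density of
reliable links tends, as `p → 0`, to `ν` if `1 - ε < ps` and to `0` if `1 - ε > ps`. -/
theorem mainTheorem12 (α R θ ε ν : ℝ) (hα : 2 < α) (hR : 0 < R) (hθ : 0 < θ)
    (hε : ε ∈ Set.Ioo (0 : ℝ) 1) (hν : 0 < ν)
    {Ω : ℝ → Type*} [∀ p, MeasurableSpace (Ω p)]
    (μ : ∀ p, Measure (Ω p)) [∀ p, IsProbabilityMeasure (μ p)]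
    (N : ∀ p, BipolarNetwork (Ω p))
    (hN : ∀ p ∈ Set.Ioc (0 : ℝ) 1, (N p).IsPoissonAlohaRayleigh (μ p) (ν / p) p) :
    ∃ ps : ℝ, (∀ p ∈ Set.Ioc (0 : ℝ) 1, (N p).meanSuccess (μ p) α R θ = ps) ∧
      (1 - ε < ps →
        Tendsto (fun p => (N p).reliableDensity (μ p) (ν / p) p α R θ ε) (𝓝[>] 0) (𝓝 ν)) ∧
      (1 - ε > ps →
        Tendsto (fun p => (N p).reliableDensity (μ p) (ν / p) p α R θ ε) (𝓝[>] 0) (𝓝 0)) := by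
  set s : ℝ := (BipolarNetwork.successLimit α R θ ν).toReal with hs
  have hp : ∀ᶠ p : ℝ in 𝓝[>] 0, p ∈ Set.Ioc (0 : ℝ) 1 := Ioc_mem_nhdsGT one_pos
  -- The deviation probabilities of the conditional success probability from `s` vanish.
  have hdev (δ : ℝ) (hδ : 0 < δ) : Tendsto (fun p ↦
      (μ p).real {ω | δ ≤ |(N p).condSuccess (μ p) α R θ ω - s|}) (𝓝[>] 0) (𝓝 0) := by
    have hB : Tendsto (fun p : ℝ ↦ (s ^ (2 - p) - s ^ 2) / δ ^ 2) (𝓝[>] 0) (𝓝 0) := by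
      have h1 : ContinuousAt (fun p : ℝ ↦ s ^ (2 - p)) 0 :=
        ContinuousAt.rpow continuousAt_const (by fun_prop) (.inr (by norm_num))
      have h2 : Tendsto (fun p : ℝ ↦ s ^ (2 - p)) (𝓝[>] 0) (𝓝 (s ^ (2 : ℕ))) := by
        simpa using h1.tendsto.mono_left nhdsWithin_le_nhds
      simpa only [sub_self, zero_div] using (h2.sub_const (s ^ (2 : ℕ))).div_const (δ ^ 2)
    refine squeeze_zero' (Eventually.of_forall fun p ↦ measureReal_nonneg) ?_ hB
    filter_upwards [hp] with p hp
    exact (hN p hp).measureReal_le_abs_sub_le hp α hR hθ hδ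
  have hlim (c : ℝ)
      (hη : Tendsto (fun p ↦ (N p).metaDist (μ p) α R θ ε) (𝓝[>] 0) (𝓝 c)) :
      Tendsto (fun p ↦ (N p).reliableDensity (μ p) (ν / p) p α R θ ε) (𝓝[>] 0) (𝓝 (ν * c)) := by
    refine (hη.const_mul ν).congr' ?_
    filter_upwards [hp] with p hp
    rw [BipolarNetwork.reliableDensity, div_mul_cancel₀ _ hp.1.ne']
  refine ⟨s, fun p hp ↦ (hN p hp).meanSuccess_eq hp α hR hθ, fun h ↦ ?_, fun h ↦ ?_⟩
  · refine (mul_one ν).subst (motive := fun c ↦ Tendsto _ _ (𝓝 c)) (hlim 1 ?_)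
    have hd := (hdev (s - (1 - ε)) (sub_pos.2 h)).const_sub 1
    rw [sub_zero] at hd
    refine tendsto_of_tendsto_of_tendsto_of_le_of_le hd tendsto_const_nhds (fun p ↦ ?_)
      fun p ↦ measureReal_le_one
    have hm : Measurable ((N p).condSuccess (μ p) α R θ) :=
      (stronglyMeasurable_condExp.mono (N p).sigmaPhi_le).measurable
    have hc := probReal_compl_eq_one_sub (μ := μ p)
      (measurableSet_lt (measurable_const (a := 1 - ε)) hm)
    have hle : (μ p).real {ω | 1 - ε < (N p).condSuccess (μ p) α R θ ω}ᶜ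
        ≤ (μ p).real {ω | s - (1 - ε) ≤ |(N p).condSuccess (μ p) α R θ ω - s|} := by
      refine measureReal_mono fun ω hω ↦ ?_
      have hω' : (N p).condSuccess (μ p) α R θ ω ≤ 1 - ε := not_lt.1 hω
      exact (by linarith : s - (1 - ε) ≤ -((N p).condSuccess (μ p) α R θ ω - s)).trans
        (neg_le_abs _)
    simp only [BipolarNetwork.metaDist]
    linarith
  · refine (mul_zero ν).subst (motive := fun c ↦ Tendsto _ _ (𝓝 c)) (hlim 0 ?_)
    refine squeeze_zero (fun p ↦ measureReal_nonneg) (fun p ↦ ?_)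
      (hdev (1 - ε - s) (sub_pos.2 h))
    refine measureReal_mono fun ω hω ↦ ?_
    exact (sub_le_sub_right (le_of_lt hω) s).trans (le_abs_self _)
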